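/- Let $X=(X_k^v)_{k,v\in\mathbb{Z}}$, $Y=(Y_k^v)_{k,v\in\mathbb{Z}}$ be $\{-1,1\}$-valued random fields on a probability space, and write $X_k=(X_k^v)_{v\in\mathbb{Z}}$, $Y_k=(Y_k^v)_{v\in\mathbb{Z}}$ for the configurations at time $k\in\mathbb{Z}$. Assume the following. (1) (Local hidden Markov model.) $(X_k,Y_k)_{k\in\mathbb{Z}}$ is a Markov chain with $$\mathbf{P}[(X_k,Y_k)\in A\mid (X_j,Y_j)_{j<k}]=\int \mathbf{1}_A(x,y)\,P(X_{k-1},dx)\,\Phi(X_{k-1},x,dy),$$ where $P$ and $\Phi$ are transition kernels that factorize as $P(x,dz)=\prod_{v\in\mathbb{Z}}P^v(x,dz^v)$ and $\Phi(x,z,dy)=\prod_{v\in\mathbb{Z}}\Phi^v(x,z,dy^v)$, and $P^v(x,\cdot)$ and $\Phi^v(x,z,\cdot)$ depend only on those $x^w,z^w$ with $|w-v|\le 1$. (2) (Observations.) $Y_k^v=X_k^v\xi_k^v$, where $(\xi_k^v)_{k,v\in\mathbb{Z}}$ are i.i.d. $\{-1,1\}$-valued random variables, independent of $X$, with $\mathbf{P}[\xi_k^v=-1]=p$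 (here $p\in[0,1]$ is arbitrary). (3) (Translation invariance.) The local transition kernel is the same at all sites, that is, $P^{v+w}(x,\cdot)=P^{v}(\theta_w x,\cdot)$ for all $v,w\in\mathbb{Z}$ and all $x$, where $(\theta_w x)^u=x^{u+w}$; and $(X_k^v,Y_k^v)_{k,v\in\mathbb{Z}}$ has the same law as $(X_{k+\ell}^{v+w},Y_{k+\ell}^{v+w})_{k,v\in\mathbb{Z}}$ for all $\ell,w\in\mathbb{Z}$. For a finite-valued random variable $Z$ and a $\sigma$-field $\mathcal{G}$, let $H(Z\mid\mathcal{G})=\mathbf{E}\big[-\sum_z \mathbf{P}[Z=z\mid\mathcal{G}]\log_2\mathbf{P}[Z=z\mid\mathcal{G}]\big]$ be the conditional entropy, with $0\log_2 0=0$; conditioning on random variables means conditioning on the $\sigma$-field that they generate. Let $Y_k^{<v}=(Y_k^w)_{w<v}$. Then, for every $v\in\mathbb{Z}$, $$H(Y_k^v\mid Y_1,\ldots,Y_{k-1},Y_k^{<v})-H(Y_k^v\mid X_0,Y_1,\ldots,Y_{k-1},Y_k^{<v})\xrightarrow{k\to\infty}0.$$ -/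

import Mathlib

open MeasureTheory ProbabilityTheory Filter Topology
open scoped ENNReal

noncomputable section

namespace SpinFilter

/-- The (Shannon) conditional entropy `H(Z | 𝒢)`, in bits, of a random variable `Z` with values in
a finite set given a `σ`-field `𝒢`:
`H(Z | 𝒢) = E[ - ∑ z, P[Z = z | 𝒢] log₂ P[Z = z | 𝒢] ]`. -/
def condEntropy {Ω S : Type*} [Fintype S] (Z : Ω → S) (𝒢 : MeasurableSpace Ω)
    {mΩ : MeasurableSpace Ω} (μ : Measure[mΩ] Ω) : ℝ :=
  ∫ ω, ∑ z : S, -((μ⟦Z ⁻¹' {z} | 𝒢⟧) ω * Real.logb 2 ((μ⟦Z ⁻¹' {z} | 𝒢⟧) ω)) ∂μ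

/-- `(X_k, Y_k)_{k ∈ ℤ}` is a hidden Markov model with transition kernel `P` and observation
kernel `Φ`: it is a Markov chain, and the conditional law of `(X_k, Y_k)` given the past is
`P(X_{k-1}, dx) Φ(X_{k-1}, x, dy)`. -/
structure IsHiddenMarkovModel {Ω 𝕏 𝕐 : Type*} {mΩ : MeasurableSpace Ω} [MeasurableSpace 𝕏]
    [MeasurableSpace 𝕐] (μ : Measure Ω) (X : ℤ → Ω → 𝕏) (Y : ℤ → Ω → 𝕐)
    (P : Kernel 𝕏 𝕏) [IsMarkovKernel P] (Φ : Kernel (𝕏 × 𝕏) 𝕐) [IsMarkovKernel Φ] : Prop where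
  measurable_state : ∀ k, Measurable (X k)
  measurable_obs : ∀ k, Measurable (Y k)
  markov : ∀ (k : ℤ) (A : Set (𝕏 × 𝕐)), MeasurableSet A →
    μ⟦(fun ω => (X k ω, Y k ω)) ⁻¹' A |
        ⨆ j : {j : ℤ // j < k}, MeasurableSpace.comap (fun ω => (X j ω, Y j ω)) inferInstance⟧
      =ᵐ[μ] fun ω => ((P ⊗ₖ Φ) (X (k - 1) ω)).real A

/-- The kernels `P` and `Φ` on configurations over the lattice `ℤ` are local: they factorize as
`P(x, dz) = ∏_v P^v(x, dz^v)` and `Φ(x, z, dy) = ∏_v Φ^v(x, z, dy^v)`, where `P^v(x, ·)` and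
`Φ^v(x, z, ·)` depend only on `x^w, z^w` for `|w - v| ≤ 1`. -/
structure IsLocalModel {E F : Type*} [MeasurableSpace E] [MeasurableSpace F]
    (P : Kernel (ℤ → E) (ℤ → E)) (Φ : Kernel ((ℤ → E) × (ℤ → E)) (ℤ → F))
    (Ploc : ℤ → Kernel (ℤ → E) E) [∀ v, IsMarkovKernel (Ploc v)]
    (Φloc : ℤ → Kernel ((ℤ → E) × (ℤ → E)) F) [∀ v, IsMarkovKernel (Φloc v)] : Prop where
  transition_eq : ∀ x, P x = Measure.infinitePi (fun v => Ploc v x)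
  obs_eq : ∀ x z, Φ (x, z) = Measure.infinitePi (fun v => Φloc v (x, z))
  transition_local : ∀ (v : ℤ) (x x' : ℤ → E),
    (∀ w, |w - v| ≤ 1 → x w = x' w) → Ploc v x = Ploc v x'
  obs_local : ∀ (v : ℤ) (x x' z z' : ℤ → E),
    (∀ w, |w - v| ≤ 1 → x w = x' w ∧ z w = z' w) → Φloc v (x, z) = Φloc v (x', z')

/-- The local transition kernel is the same at every site: the kernel at `v + w`
is the kernel at `v` applied to the configuration seen from `w`. -/
def SameLocalKernels {E : Type*} [MeasurableSpace E] (Ploc : ℤ → Kernel (ℤ → E) E) : Prop :=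
  ∀ (v w : ℤ) (x : ℤ → E), Ploc (v + w) x = Ploc v (fun u => x (u + w))

/-- The space-time random field `(X_k^v, Y_k^v)_{k, v ∈ ℤ}` has the same law as
`(X_{k+ℓ}^{v+w}, Y_{k+ℓ}^{v+w})_{k, v ∈ ℤ}` for all `ℓ, w ∈ ℤ`. In particular (`w = 0`), the
process is stationary. -/
def IsTranslationInvariant {Ω E F : Type*} {mΩ : MeasurableSpace Ω} [MeasurableSpace E]
    [MeasurableSpace F] (μ : Measure Ω) (X : ℤ → Ω → ℤ → E) (Y : ℤ → Ω → ℤ → F) : Prop :=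
  ∀ l w : ℤ, IdentDistrib
    (fun ω (q : ℤ × ℤ) => (X q.1 ω q.2, Y q.1 ω q.2))
    (fun ω (q : ℤ × ℤ) => (X (q.1 + l) ω (q.2 + w), Y (q.1 + l) ω (q.2 + w))) μ μ

/-- The observations, with values in `{-1, 1}`, are `Y_k^v = X_k^v ξ_k^v`, where
`(ξ_k^v)_{k, v ∈ ℤ}` are i.i.d., independent of `X`, and `P[ξ_k^v = -1] = p`. -/
structure HasSpinNoise {Ω : Type*} {mΩ : MeasurableSpace Ω} (μ : Measure Ω)
    (X Y : ℤ → Ω → ℤ → ℤˣ) (p : ℝ) (ξ : ℤ → Ω → ℤ → ℤˣ) : Prop where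
  measurable_noise : ∀ k, Measurable (ξ k)
  obs_eq : ∀ k ω v, Y k ω v = X k ω v * ξ k ω v
  iIndep : iIndepFun (fun (q : ℤ × ℤ) ω => ξ q.1 ω q.2) μ
  prob : ∀ k v, μ.real {ω | ξ k ω v = -1} = p
  indep : IndepFun (fun ω k => X k ω) (fun ω k => ξ k ω) μ

/-- The `σ`-field generated by `Y_1, …, Y_{k-1}` and `Y_k^{<v} = (Y_k^w)_{w < v}`. -/
@[reducible]
def obsPast {Ω F : Type*} [MeasurableSpace F] (Y : ℤ → Ω → ℤ → F) (k v : ℤ) :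
    MeasurableSpace Ω :=
  (⨆ j : {j : ℤ // 1 ≤ j ∧ j ≤ k - 1}, MeasurableSpace.comap (Y j) inferInstance) ⊔
    ⨆ w : {w : ℤ // w < v}, MeasurableSpace.comap (fun ω => Y k ω w) inferInstance

/-- The `σ`-field generated by the whole initial configuration `X_0`. -/
@[reducible]
def initialField {Ω E : Type*} [MeasurableSpace E] (X : ℤ → Ω → ℤ → E) : MeasurableSpace Ω :=
  MeasurableSpace.comap (X 0) inferInstance

end SpinFilter

end

/-! Put `X 0` in row `0` of a planar field and the observations in the other rows; this field is
stationary under horizontal shifts. Let `pastEntropy` `1` and `0` denote the entropies of a site in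
row `j` given its lexicographic past without and with row `0`. Their difference is nonnegative,
since conditioning reduces entropy.

By the chain rule, the entropy per column of a wide rectangle is asymptotically the sum over its
rows of these entropies. Adding row `0` to rows `1, …, k` can only raise the joint entropy, and row
`0` itself costs at most a constant `C` per site. Hence the differences over rows `1, …, k` sum to
at most `C` for every `k` (`sum_pastEntropy_sub_le`). They are therefore summable in `j`, so they
tend to `0`.

The two estimates behind this are `mul_pastEntropy_le` (no boundary loss) and
`exists_jointEntropy_sub_le` (boundary loss bounded in the width). -/

noncomputable section

namespace SpinFilter

/-! ### Conditional entropy: monotonicity, continuity, chain rule. -/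

section CondEntropy

variable {Ω S T : Type*} [Fintype S] {𝒢 𝒢' : MeasurableSpace Ω} {mΩ : MeasurableSpace Ω}
  {μ : Measure Ω}

lemma negMulLog_mem_Icc {x : ℝ} (hx : x ∈ Set.Icc (0 : ℝ) 1) :
    Real.negMulLog x ∈ Set.Icc (0 : ℝ) 1 :=
  ⟨Real.negMulLog_nonneg hx.1 hx.2, by linarith [Real.negMulLog_le_one_sub_self hx.1, hx.1]⟩

lemma aestronglyMeasurable_negMulLog_condProb (h𝒢 : 𝒢 ≤ mΩ) (A : Set Ω) :
    AEStronglyMeasurable (fun ω => Real.negMulLog ((μ⟦A | 𝒢⟧) ω)) μ :=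
  Real.continuous_negMulLog.comp_aestronglyMeasurable
    (stronglyMeasurable_condExp.mono h𝒢).aestronglyMeasurable

variable [Fintype T]

/-- The Shannon entropy, in bits, of a random variable with values in a finite set. -/
def entropy (W : Ω → T) (μ : Measure Ω) : ℝ :=
  (∑ t, Real.negMulLog (μ.real (W ⁻¹' {t}))) / Real.log 2

lemma entropy_comp_injective {T' : Type*} [Fintype T'] (W : Ω → T) {e : T → T'}
    (he : Function.Injective e) : entropy (e ∘ W) μ = entropy W μ := by
  unfold entropy
  congr 1
  symm
  refine Finset.sum_of_injOn e he.injOn (by simp) (fun t _ ht => ?_) fun t _ => ?_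
  · have : (e ∘ W) ⁻¹' {t} = ∅ := by
      ext ω
      simp only [Set.mem_preimage, Function.comp_apply, Set.mem_singleton_iff,
        Set.mem_empty_iff_false, iff_false]
      exact fun h => ht ⟨W ω, by simp, h⟩
    simp [this]
  · congr 2
    ext ω
    simp [he.eq_iff]

lemma entropy_congr_of_identDistrib [MeasurableSpace T] [MeasurableSingletonClass T]
    {W W' : Ω → T} (h : IdentDistrib W W' μ μ) : entropy W μ = entropy W' μ := by
  unfold entropy
  simp_rw [Measure.real, h.measure_mem_eq (measurableSet_singleton _)]

variable [IsProbabilityMeasure μ]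

lemma condProb_mem_Icc (h𝒢 : 𝒢 ≤ mΩ) {A : Set Ω} (hA : MeasurableSet A) :
    ∀ᵐ ω ∂μ, (μ⟦A | 𝒢⟧) ω ∈ Set.Icc (0 : ℝ) 1 := by
  refine (convex_Icc (0 : ℝ) 1).condExp_mem h𝒢 ((integrable_const (1 : ℝ)).indicator hA)
    isClosed_Icc (Eventually.of_forall fun ω => ?_)
  by_cases h : ω ∈ A <;> simp [h]

lemma negMulLog_condProb_mem_Icc (h𝒢 : 𝒢 ≤ mΩ) {A : Set Ω} (hA : MeasurableSet A) :
    ∀ᵐ ω ∂μ, Real.negMulLog ((μ⟦A | 𝒢⟧) ω) ∈ Set.Icc (0 : ℝ) 1 :=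
  (condProb_mem_Icc h𝒢 hA).mono fun _ => negMulLog_mem_Icc

lemma integrable_negMulLog_condProb (h𝒢 : 𝒢 ≤ mΩ) {A : Set Ω} (hA : MeasurableSet A) :
    Integrable (fun ω => Real.negMulLog ((μ⟦A | 𝒢⟧) ω)) μ :=
  Integrable.of_mem_Icc 0 1 (aestronglyMeasurable_negMulLog_condProb h𝒢 A).aemeasurable
    (negMulLog_condProb_mem_Icc h𝒢 hA)

lemma condEntropy_eq_sum [MeasurableSpace S] [MeasurableSingletonClass S] {Z : Ω → S}
    (hZ : Measurable Z) (h𝒢 : 𝒢 ≤ mΩ) :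
    condEntropy Z 𝒢 μ =
      (∑ z, ∫ ω, Real.negMulLog ((μ⟦Z ⁻¹' {z} | 𝒢⟧) ω) ∂μ) / Real.log 2 := by
  rw [← integral_finsetSum _ fun z _ =>
    integrable_negMulLog_condProb h𝒢 (hZ (measurableSet_singleton z)), ← integral_div]
  refine integral_congr_ae (Eventually.of_forall fun ω => ?_)
  simp only [Finset.sum_div]
  refine Finset.sum_congr rfl fun z _ => ?_
  simp only [Real.negMulLog, Real.logb]
  ring

lemma condEntropy_nonneg [MeasurableSpace S] [MeasurableSingletonClass S] {Z : Ω → S}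
    (hZ : Measurable Z) (h𝒢 : 𝒢 ≤ mΩ) : 0 ≤ condEntropy Z 𝒢 μ := by
  rw [condEntropy_eq_sum hZ h𝒢]
  refine div_nonneg (Finset.sum_nonneg fun z _ => integral_nonneg_of_ae ?_)
    (Real.log_nonneg one_le_two)
  exact (negMulLog_condProb_mem_Icc h𝒢 (hZ (measurableSet_singleton z))).mono fun _ h => h.1

lemma condEntropy_le_card_div [MeasurableSpace S] [MeasurableSingletonClass S] {Z : Ω → S}
    (hZ : Measurable Z) (h𝒢 : 𝒢 ≤ mΩ) :
    condEntropy Z 𝒢 μ ≤ Fintype.card S / Real.log 2 := by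
  rw [condEntropy_eq_sum hZ h𝒢]
  refine div_le_div_of_nonneg_right ?_ (Real.log_nonneg one_le_two)
  have h : ∀ z ∈ (Finset.univ : Finset S),
      ∫ ω, Real.negMulLog ((μ⟦Z ⁻¹' {z} | 𝒢⟧) ω) ∂μ ≤ 1 := fun z _ => by
    have hm := hZ (measurableSet_singleton z)
    calc _ ≤ ∫ _, (1 : ℝ) ∂μ := integral_mono_ae (integrable_negMulLog_condProb h𝒢 hm)
          (integrable_const _) ((negMulLog_condProb_mem_Icc h𝒢 hm).mono fun _ h => h.2)
      _ = 1 := by simp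
  simpa using Finset.sum_le_sum h

/-- Conditioning on more information reduces entropy. -/
lemma condEntropy_anti [MeasurableSpace S] [MeasurableSingletonClass S] {Z : Ω → S}
    (hZ : Measurable Z) (h : 𝒢 ≤ 𝒢') (h𝒢' : 𝒢' ≤ mΩ) :
    condEntropy Z 𝒢' μ ≤ condEntropy Z 𝒢 μ := by
  rw [condEntropy_eq_sum hZ h𝒢', condEntropy_eq_sum hZ (h.trans h𝒢')]
  refine div_le_div_of_nonneg_right (Finset.sum_le_sum fun z _ => ?_)
    (Real.log_nonneg one_le_two)
  have hm := hZ (measurableSet_singleton z)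
  have h𝒢 := h.trans h𝒢'
  -- Conditional Jensen for the concave `negMulLog`, to be combined with the tower property.
  have hJ := Real.concaveOn_negMulLog.condExp_map_le (μ := μ) h𝒢
    Real.continuous_negMulLog.continuousOn.upperSemicontinuousOn
    ((condProb_mem_Icc h𝒢' hm).mono fun _ h => h.1) isClosed_Ici integrable_condExp
    (integrable_negMulLog_condProb h𝒢' hm)
  rw [← integral_condExp h𝒢 (f := fun ω => Real.negMulLog ((μ⟦Z ⁻¹' {z} | 𝒢'⟧) ω))]
  refine integral_mono_ae integrable_condExp (integrable_negMulLog_condProb h𝒢 hm) ?_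
  filter_upwards [hJ, condExp_condExp_of_le (μ := μ) (f := (Z ⁻¹' {z}).indicator fun _ => (1 : ℝ))
    h h𝒢'] with ω h1 h2
  simp only [Function.comp_apply, h2] at h1
  exact h1

/-- Lévy's upward theorem, then dominated convergence: `negMulLog` is continuous and bounded by `1`
on `[0, 1]`. -/
lemma tendsto_condEntropy_iSup [MeasurableSpace S] [MeasurableSingletonClass S] {Z : Ω → S}
    (hZ : Measurable Z) (ℱ : Filtration ℕ mΩ) :
    Tendsto (fun n => condEntropy Z (ℱ n) μ) atTop (𝓝 (condEntropy Z (⨆ n, ℱ n) μ)) := by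
  rw [condEntropy_eq_sum hZ (iSup_le ℱ.le)]
  simp_rw [fun n => condEntropy_eq_sum (μ := μ) hZ (ℱ.le n)]
  refine (tendsto_finsetSum _ fun z _ => ?_).div_const _
  have hm := hZ (measurableSet_singleton z)
  refine tendsto_integral_of_dominated_convergence (fun _ => 1)
    (fun n => aestronglyMeasurable_negMulLog_condProb (ℱ.le n) _) (integrable_const _)
    (fun n => (negMulLog_condProb_mem_Icc (ℱ.le n) hm).mono fun ω h => ?_) ?_
  · rw [Real.norm_of_nonneg h.1]; exact h.2
  · filter_upwards [tendsto_ae_condExp (μ := μ) (ℱ := ℱ) ((Z ⁻¹' {z}).indicator fun _ => (1 : ℝ))]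
      with ω h
    exact (Real.continuous_negMulLog.tendsto _).comp h

/-- The chain rule. Each conditional probability is a function `f z` of `W`, and expanding
`negMulLog` of the product `P[W = t] * f z t` separates the two entropies. -/
lemma condEntropy_comap [MeasurableSpace S] [MeasurableSingletonClass S] [MeasurableSpace T]
    [MeasurableSingletonClass T] {Z : Ω → S} {W : Ω → T} (hZ : Measurable Z) (hW : Measurable W) :
    condEntropy Z (MeasurableSpace.comap W inferInstance) μ =
      entropy (fun ω => (Z ω, W ω)) μ - entropy W μ := by
  have key : ∀ z, ∃ f : T → ℝ, μ⟦Z ⁻¹' {z} | MeasurableSpace.comap W inferInstance⟧ = f ∘ W ∧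
      ∀ t, μ.real ((fun ω => (Z ω, W ω)) ⁻¹' {(z, t)}) = μ.real (W ⁻¹' {t}) * f t := by
    intro z
    have hm := hZ (measurableSet_singleton z)
    obtain ⟨f, -, hf⟩ := (stronglyMeasurable_condExp (μ := μ)
      (m := MeasurableSpace.comap W inferInstance)
      (f := (Z ⁻¹' {z}).indicator fun _ => (1 : ℝ))).measurable.exists_eq_measurable_comp
    refine ⟨f, hf, fun t => ?_⟩
    have hWt := hW (measurableSet_singleton t)
    have h1 := setIntegral_condExp (μ := μ) hW.comap_le
      ((integrable_const (1 : ℝ)).indicator hm) (s := W ⁻¹' {t})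
      ⟨{t}, measurableSet_singleton t, rfl⟩
    rw [hf, setIntegral_congr_fun (g := fun _ => f t) hWt
      (fun ω hω => by simp only [Set.mem_preimage, Set.mem_singleton_iff] at hω; simp [hω]),
      setIntegral_const, setIntegral_indicator hm, setIntegral_const] at h1
    simp only [smul_eq_mul, mul_one] at h1
    rw [h1]
    congr 1
    ext ω
    simp [and_comm]
  choose f hf hfμ using key
  rw [condEntropy_eq_sum hZ hW.comap_le]
  unfold entropy
  rw [← sub_div]
  congr 1
  have hint : ∀ z, ∫ ω, Real.negMulLog
      ((μ⟦Z ⁻¹' {z} | MeasurableSpace.comap W inferInstance⟧) ω) ∂μ =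
      ∑ t, μ.real (W ⁻¹' {t}) * Real.negMulLog (f z t) := by
    intro z
    rw [hf]
    have hmap := integral_map (μ := μ) hW.aemeasurable
      (f := fun t => Real.negMulLog (f z t)) (StronglyMeasurable.of_discrete).aestronglyMeasurable
    have : IsProbabilityMeasure (μ.map W) := Measure.isProbabilityMeasure_map hW.aemeasurable
    simp only [Function.comp_apply]
    rw [← hmap, integral_fintype (Integrable.of_finite)]
    refine Finset.sum_congr rfl fun t _ => ?_
    rw [map_measureReal_apply hW (measurableSet_singleton t), smul_eq_mul]
  -- The weight stays in place: `∑ z, f z t = 1` may fail where `W = t` is null.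
  have hsum : ∀ t, ∑ z, μ.real (W ⁻¹' {t}) * f z t = μ.real (W ⁻¹' {t}) := by
    intro t
    simp_rw [← hfμ]
    rw [← measureReal_biUnion_finset]
    · congr 1
      ext ω
      simp
    · intro z _ z' _ hzz
      refine Set.disjoint_left.2 fun ω h h' => hzz ?_
      simp only [Set.mem_preimage, Set.mem_singleton_iff, Prod.mk.injEq] at h h'
      rw [← h.1, h'.1]
    · exact fun z _ => (hZ.prodMk hW) (measurableSet_singleton _)
  simp_rw [hint]
  rw [Fintype.sum_prod_type, Finset.sum_comm, Finset.sum_comm (s := Finset.univ (α := S)),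
    ← Finset.sum_sub_distrib]
  refine Finset.sum_congr rfl fun t _ => ?_
  simp_rw [hfμ, Real.negMulLog_mul, Finset.sum_add_distrib]
  have : ∑ z, f z t * Real.negMulLog (μ.real (W ⁻¹' {t})) =
      Real.negMulLog (μ.real (W ⁻¹' {t})) := by
    conv_rhs => rw [Real.negMulLog, ← hsum t, neg_mul, Finset.sum_mul, ← Finset.sum_neg_distrib]
    refine Finset.sum_congr rfl fun z _ => ?_
    rw [hsum t, Real.negMulLog]
    ring
  rw [this]
  ring

end CondEntropy


/-! ### Joint entropies of random fields. -/

section RandomField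

variable {Ω I S : Type*} [MeasurableSpace S]

/-- The `σ`-field generated by the variables of the random field `V` with index in `A`. -/
@[reducible]
def fieldSigma (V : I → Ω → S) (A : Set I) : MeasurableSpace Ω :=
  ⨆ q : A, MeasurableSpace.comap (V q) inferInstance

lemma fieldSigma_mono (V : I → Ω → S) {A B : Set I} (h : A ⊆ B) :
    fieldSigma V A ≤ fieldSigma V B :=
  iSup_le fun q => le_iSup (fun q : B => MeasurableSpace.comap (V q) inferInstance) ⟨q, h q.2⟩

lemma iSup_fieldSigma {κ : Type*} (V : I → Ω → S) (A : κ → Set I) :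
    ⨆ n, fieldSigma V (A n) = fieldSigma V (⋃ n, A n) := by
  refine le_antisymm (iSup_le fun n => fieldSigma_mono V (Set.subset_iUnion A n))
    (iSup_le fun q => ?_)
  obtain ⟨n, hn⟩ := Set.mem_iUnion.1 q.2
  exact (le_iSup (fun q : A n => MeasurableSpace.comap (V q) inferInstance) ⟨q, hn⟩).trans
    (le_iSup (fun n => fieldSigma V (A n)) n)

lemma fieldSigma_eq_comap (V : I → Ω → S) (A : Set I) :
    fieldSigma V A = MeasurableSpace.comap (fun ω (q : A) => V q ω) inferInstance := by
  simp only [fieldSigma, MeasurableSpace.pi, MeasurableSpace.comap_iSup,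
    MeasurableSpace.comap_comp]
  rfl

variable {mΩ : MeasurableSpace Ω} {μ : Measure Ω} {V : I → Ω → S}

lemma fieldSigma_le (hV : ∀ q, Measurable (V q)) (A : Set I) : fieldSigma V A ≤ mΩ :=
  iSup_le fun q => (hV q).comap_le

lemma tendsto_condEntropy_fieldSigma [Fintype S] [MeasurableSingletonClass S]
    [IsProbabilityMeasure μ] (hV : ∀ q, Measurable (V q)) (q : I) {A : ℕ → Set I}
    (hA : Monotone A) :
    Tendsto (fun n => condEntropy (V q) (fieldSigma V (A n)) μ) atTop
      (𝓝 (condEntropy (V q) (fieldSigma V (⋃ n, A n)) μ)) := by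
  have := tendsto_condEntropy_iSup (μ := μ) (hV q)
    ⟨fun n => fieldSigma V (A n), fun _ _ h => fieldSigma_mono V (hA h),
      fun n => fieldSigma_le hV (A n)⟩
  simpa only [← iSup_fieldSigma] using this

variable [Fintype S] [DecidableEq I]

/-- The joint entropy of the variables of the random field `V` with index in the finite set `A`. -/
def jointEntropy (V : I → Ω → S) (μ : Measure Ω) (A : Finset I) : ℝ :=
  entropy (fun ω (q : A) => V q ω) μ

variable [MeasurableSingletonClass S]

/-- Relabelling loses no information: a configuration on the image is determined by its pullback
along `s`, even when `s` is not injective. -/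
lemma jointEntropy_image (s : I → I)
    (hs : IdentDistrib (fun ω q => V q ω) (fun ω q => V (s q) ω) μ μ) (A : Finset I) :
    jointEntropy V μ (A.image s) = jointEntropy V μ A := by
  let e : (↥(A.image s) → S) → (A → S) := fun x a => x ⟨s a, Finset.mem_image_of_mem s a.2⟩
  have he : Function.Injective e := fun x y hxy => by
    ext ⟨a, ha⟩
    obtain ⟨b, hb, rfl⟩ := Finset.mem_image.1 ha
    exact congr_fun hxy ⟨b, hb⟩
  have h1 := entropy_comp_injective (μ := μ) (fun ω (a : ↥(A.image s)) => V a ω) he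
  have h2 := entropy_congr_of_identDistrib (hs.comp (u := fun x (a : A) => x a)
    (measurable_pi_lambda _ fun a => measurable_pi_apply _))
  unfold jointEntropy
  calc _ = _ := h1.symm
    _ = _ := h2.symm

variable [IsProbabilityMeasure μ]

lemma jointEntropy_insert (hV : ∀ q, Measurable (V q)) (q : I) (A : Finset I) :
    jointEntropy V μ (insert q A) =
      jointEntropy V μ A + condEntropy (V q) (fieldSigma V A) μ := by
  have h := condEntropy_comap (μ := μ) (hV q) (W := fun ω (q : A) => V q ω)
    (measurable_pi_lambda _ fun q => hV q)
  let e : (↥(insert q A) → S) → S × (A → S) := fun x =>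
    (x ⟨q, Finset.mem_insert_self q A⟩, fun a => x ⟨a, Finset.mem_insert_of_mem a.2⟩)
  have he : Function.Injective e := fun x y hxy => by
    simp only [e, Prod.mk.injEq, funext_iff] at hxy
    ext ⟨a, ha⟩
    rcases Finset.mem_insert.1 ha with rfl | ha'
    · exact hxy.1
    · exact hxy.2 ⟨a, ha'⟩
  have h2 := entropy_comp_injective (μ := μ) (fun ω (a : ↥(insert q A)) => V a ω) he
  have h3 : fieldSigma V (A : Set I) =
    MeasurableSpace.comap (fun ω (q : A) => V q ω) inferInstance := fieldSigma_eq_comap V _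
  rw [h3, h, ← sub_eq_iff_eq_add']
  unfold jointEntropy
  rw [← h2]
  rfl

lemma jointEntropy_mono (hV : ∀ q, Measurable (V q)) {A B : Finset I} (h : A ⊆ B) :
    jointEntropy V μ A ≤ jointEntropy V μ B := by
  have key : ∀ C : Finset I, jointEntropy V μ A ≤ jointEntropy V μ (C ∪ A) := fun C => by
    induction C using Finset.induction_on with
    | empty => simp
    | insert q C _ ih =>
      rw [Finset.insert_union, jointEntropy_insert hV]
      linarith [condEntropy_nonneg (μ := μ) (hV q) (fieldSigma_le hV ↑(C ∪ A))]
  simpa [Finset.union_eq_left.2 h] using key B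

/-- A conditional entropy given finitely many sites is a difference of joint entropies, so
invariance of the latter suffices; no conditional expectation has to be transported. -/
lemma condEntropy_image (hV : ∀ q, Measurable (V q)) (s : I → I)
    (hs : IdentDistrib (fun ω q => V q ω) (fun ω q => V (s q) ω) μ μ) (q : I) (A : Finset I) :
    condEntropy (V (s q)) (fieldSigma V ↑(A.image s)) μ =
      condEntropy (V q) (fieldSigma V ↑A) μ := by
  have h1 := jointEntropy_insert (μ := μ) hV q A
  have h2 := jointEntropy_insert (μ := μ) hV (s q) (A.image s)
  rw [← Finset.image_insert, jointEntropy_image s hs, jointEntropy_image s hs] at h2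
  linarith

end RandomField

lemma jointEntropy_empty {Ω I S : Type*} [Fintype S] [DecidableEq I] {mΩ : MeasurableSpace Ω}
    {μ : Measure Ω} [IsProbabilityMeasure μ] {V : I → Ω → S} : jointEntropy V μ ∅ = 0 := by
  unfold jointEntropy entropy
  have : ∀ t, (fun ω (q : (∅ : Finset I)) => V q ω) ⁻¹' {t} = Set.univ := fun t => by
    ext ω
    simp only [Set.mem_preimage, Set.mem_singleton_iff, Set.mem_univ, iff_true]
    exact Subsingleton.elim _ _
  simp [this]

/-! ### Entropy of rectangles in a horizontally stationary planar field. -/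

section Lattice

variable {Ω S : Type*} [MeasurableSpace S] [MeasurableSingletonClass S] [Fintype S]
  {mΩ : MeasurableSpace Ω} {μ : Measure Ω} [IsProbabilityMeasure μ] {V : ℤ × ℤ → Ω → S}

/-- The lexicographic past of the site `(j, v)`, restricted to the rows from `a` on. -/
def lexPast (a j v : ℤ) : Set (ℤ × ℤ) :=
  {q | a ≤ q.1 ∧ q.1 < j ∨ q.1 = j ∧ q.2 < v}

/-- The part of `lexPast a j v` at horizontal distance at most `m` from `v`. -/
def lexWindow (a j v : ℤ) (m : ℕ) : Finset (ℤ × ℤ) :=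
  Finset.Ico a j ×ˢ Finset.Icc (v - m) (v + m) ∪ {j} ×ˢ Finset.Ico (v - m) v

/-- The entropy of `V` at `(j, v)` given its lexicographic past in the rows from `a` on. -/
def pastEntropy (V : ℤ × ℤ → Ω → S) (μ : Measure Ω) (a j v : ℤ) : ℝ :=
  condEntropy (V (j, v)) (fieldSigma V (lexPast a j v)) μ

lemma mem_lexWindow {a j v : ℤ} {m : ℕ} {q : ℤ × ℤ} :
    q ∈ lexWindow a j v m ↔ (a ≤ q.1 ∧ q.1 < j) ∧ v - m ≤ q.2 ∧ q.2 ≤ v + m ∨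
      q.1 = j ∧ v - m ≤ q.2 ∧ q.2 < v := by
  obtain ⟨i, u⟩ := q
  simp only [lexWindow, Finset.mem_union, Finset.mem_product, Finset.mem_Ico, Finset.mem_Icc,
    Finset.mem_singleton]

lemma iUnion_lexWindow (a j v : ℤ) : ⋃ m, (lexWindow a j v m : Set (ℤ × ℤ)) = lexPast a j v := by
  ext ⟨i, u⟩
  simp only [Set.mem_iUnion, Finset.mem_coe, mem_lexWindow, lexPast, Set.mem_ofPred_eq]
  constructor
  · rintro ⟨m, h⟩
    omega
  · intro h
    refine ⟨(u - v).natAbs, ?_⟩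
    omega

lemma lexWindow_mono (a j v : ℤ) : Monotone (lexWindow a j v) := fun m m' h q hq => by
  rw [mem_lexWindow] at hq ⊢
  omega

lemma lexWindow_image (a j v w : ℤ) (m : ℕ) :
    (lexWindow a j v m).image (fun q => (q.1, q.2 + w)) = lexWindow a j (v + w) m := by
  ext ⟨i, u⟩
  simp only [Finset.mem_image, mem_lexWindow, Prod.mk.injEq, Prod.exists]
  constructor
  · rintro ⟨i, u, h, rfl, rfl⟩
    omega
  · exact fun h => ⟨i, u - w, by omega, rfl, by omega⟩

lemma tendsto_condEntropy_lexWindow (hV : ∀ q, Measurable (V q)) (a j v : ℤ) :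
    Tendsto (fun m => condEntropy (V (j, v)) (fieldSigma V (lexWindow a j v m)) μ) atTop
      (𝓝 (pastEntropy V μ a j v)) := by
  have := tendsto_condEntropy_fieldSigma (μ := μ) hV (j, v)
    (A := fun m => (lexWindow a j v m : Set (ℤ × ℤ)))
    (fun m m' h => Finset.coe_subset.2 (lexWindow_mono a j v h))
  rwa [iUnion_lexWindow] at this

lemma condEntropy_lexWindow_eq (hV : ∀ q, Measurable (V q))
    (hinv : ∀ w : ℤ, IdentDistrib (fun ω q => V q ω) (fun ω q => V (q.1, q.2 + w) ω) μ μ)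
    (a j v : ℤ) (m : ℕ) :
    condEntropy (V (j, v)) (fieldSigma V (lexWindow a j v m)) μ =
      condEntropy (V (j, 0)) (fieldSigma V (lexWindow a j 0 m)) μ := by
  have := condEntropy_image hV _ (hinv v) (j, 0) (lexWindow a j 0 m)
  rwa [lexWindow_image, zero_add] at this

/-- Invariance holds for the finite windows and passes to the limit. -/
lemma pastEntropy_eq (hV : ∀ q, Measurable (V q))
    (hinv : ∀ w : ℤ, IdentDistrib (fun ω q => V q ω) (fun ω q => V (q.1, q.2 + w) ω) μ μ)
    (a j v : ℤ) : pastEntropy V μ a j v = pastEntropy V μ a j 0 := by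
  refine tendsto_nhds_unique (tendsto_condEntropy_lexWindow hV a j v) ?_
  simp_rw [condEntropy_lexWindow_eq hV hinv a j v]
  exact tendsto_condEntropy_lexWindow hV a j 0

/-- The rectangle `[a, b) × [0, n)` of the lattice. -/
def rect (a b : ℤ) (n : ℕ) : Finset (ℤ × ℤ) := Finset.Ico a b ×ˢ Finset.Ico 0 (n : ℤ)

lemma mem_rect {a b : ℤ} {n : ℕ} {q : ℤ × ℤ} :
    q ∈ rect a b n ↔ (a ≤ q.1 ∧ q.1 < b) ∧ 0 ≤ q.2 ∧ q.2 < n := by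
  simp [rect]

lemma rect_add_one {a j : ℤ} (h : a ≤ j) (n : ℕ) :
    rect a (j + 1) n = rect a j n ∪ rect j (j + 1) n := by
  ext q
  simp only [Finset.mem_union, mem_rect]
  omega

/-- Chain rule, filling row `j` from left to right. -/
lemma jointEntropy_rect_add_one (hV : ∀ q, Measurable (V q)) {a j : ℤ} (h : a ≤ j) (n : ℕ) :
    jointEntropy V μ (rect a (j + 1) n) = jointEntropy V μ (rect a j n) +
      ∑ i ∈ Finset.range n, condEntropy (V (j, i))
        (fieldSigma V ↑(rect a j n ∪ rect j (j + 1) i)) μ := by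
  rw [rect_add_one h]
  have key : ∀ l : ℕ, jointEntropy V μ (rect a j n ∪ rect j (j + 1) l) =
      jointEntropy V μ (rect a j n) + ∑ i ∈ Finset.range l, condEntropy (V (j, i))
        (fieldSigma V ↑(rect a j n ∪ rect j (j + 1) i)) μ := fun l => by
    induction l with
    | zero => simp [rect]
    | succ l ih =>
      have : rect a j n ∪ rect j (j + 1) (l + 1) =
          insert (j, (l : ℤ)) (rect a j n ∪ rect j (j + 1) l) := by
        ext ⟨i, u⟩
        simp only [Finset.mem_union, Finset.mem_insert, mem_rect, Prod.mk.injEq]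
        push_cast
        omega
      rw [this, jointEntropy_insert hV, ih, Finset.sum_range_succ, add_assoc]
  exact key n

/-- The sites already filled lie in the full lexicographic past, so each new site contributes at
least `pastEntropy`. -/
lemma mul_pastEntropy_le (hV : ∀ q, Measurable (V q))
    (hinv : ∀ w : ℤ, IdentDistrib (fun ω q => V q ω) (fun ω q => V (q.1, q.2 + w) ω) μ μ)
    {a j : ℤ} (h : a ≤ j) (n : ℕ) :
    n * pastEntropy V μ a j 0 ≤
      jointEntropy V μ (rect a (j + 1) n) - jointEntropy V μ (rect a j n) := by
  rw [jointEntropy_rect_add_one hV h, add_sub_cancel_left]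
  have key : ∀ i ∈ Finset.range n, pastEntropy V μ a j 0 ≤
      condEntropy (V (j, i)) (fieldSigma V ↑(rect a j n ∪ rect j (j + 1) i)) μ := fun i _ => by
    rw [← pastEntropy_eq hV hinv a j i]
    refine condEntropy_anti (hV _) (fieldSigma_mono V fun q hq => ?_) (fieldSigma_le hV _)
    simp only [Finset.coe_union, Set.mem_union, Finset.mem_coe, mem_rect] at hq
    simp only [lexPast, Set.mem_ofPred_eq]
    omega
  simpa using Finset.sum_le_sum key

lemma card_filter_near_boundary_le (m n : ℕ) :
    ((Finset.range n).filter fun i => i < m ∨ n ≤ i + m).card ≤ 2 * m := by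
  refine (Finset.card_le_card (t := Finset.range m ∪ Finset.Ico (n - m) n) fun i hi => ?_).trans
    ((Finset.card_union_le _ _).trans ?_)
  · simp only [Finset.mem_filter, Finset.mem_range, Finset.mem_union, Finset.mem_Ico] at hi ⊢
    omega
  · simp only [Finset.card_range, Nat.card_Ico]
    omega

/-- Choose a window of radius `m` that already gives `pastEntropy` up to `ε`. It fits among the
sites already filled except for at most `2 * m` sites near the ends of the row, whatever the width
`n`; those are bounded crudely by `C` each. -/
lemma exists_jointEntropy_sub_le (hV : ∀ q, Measurable (V q))
    (hinv : ∀ w : ℤ, IdentDistrib (fun ω q => V q ω) (fun ω q => V (q.1, q.2 + w) ω) μ μ)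
    {a j : ℤ} (h : a ≤ j) {ε : ℝ} (hε : 0 < ε) :
    ∃ M : ℝ, ∀ n : ℕ, jointEntropy V μ (rect a (j + 1) n) - jointEntropy V μ (rect a j n) ≤
      n * (pastEntropy V μ a j 0 + ε) + M := by
  obtain ⟨m, hm⟩ := ((tendsto_condEntropy_lexWindow (μ := μ) hV a j 0).eventually
    (eventually_le_nhds (lt_add_of_pos_right _ hε))).exists
  set C : ℝ := Fintype.card S / Real.log 2
  have hC : 0 ≤ C := div_nonneg (Nat.cast_nonneg _) (Real.log_nonneg one_le_two)
  have hD : 0 ≤ pastEntropy V μ a j 0 + ε :=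
    add_nonneg (condEntropy_nonneg (hV _) (fieldSigma_le hV _)) hε.le
  refine ⟨(2 * m : ℕ) * C, fun n => ?_⟩
  rw [jointEntropy_rect_add_one hV h, add_sub_cancel_left]
  have key : ∀ i ∈ Finset.range n,
      condEntropy (V (j, i)) (fieldSigma V ↑(rect a j n ∪ rect j (j + 1) i)) μ ≤
        (pastEntropy V μ a j 0 + ε) + if i < m ∨ n ≤ i + m then C else 0 := fun i hi => by
    split_ifs with hc
    · exact (condEntropy_le_card_div (hV _) (fieldSigma_le hV _)).trans
        (le_add_of_nonneg_left hD)
    · rw [add_zero]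
      refine le_trans ?_ hm
      rw [← condEntropy_lexWindow_eq hV hinv a j i m]
      refine condEntropy_anti (hV _) (fieldSigma_mono V fun q hq => ?_) (fieldSigma_le hV _)
      simp only [Finset.mem_coe, mem_lexWindow] at hq
      simp only [Finset.coe_union, Set.mem_union, Finset.mem_coe, mem_rect]
      omega
  refine (Finset.sum_le_sum key).trans ?_
  rw [Finset.sum_add_distrib, Finset.sum_const, Finset.card_range, nsmul_eq_mul,
    ← Finset.sum_filter, Finset.sum_const, nsmul_eq_mul]
  gcongr
  exact card_filter_near_boundary_le m n

lemma mul_sum_pastEntropy_le (hV : ∀ q, Measurable (V q))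
    (hinv : ∀ w : ℤ, IdentDistrib (fun ω q => V q ω) (fun ω q => V (q.1, q.2 + w) ω) μ μ)
    (n k : ℕ) :
    n * ∑ j ∈ Finset.range k, pastEntropy V μ 1 (j + 1) 0 ≤
      jointEntropy V μ (rect 1 (k + 1) n) := by
  induction k with
  | zero => simp [rect, jointEntropy_empty]
  | succ k ih =>
    rw [Finset.sum_range_succ, mul_add]
    have := mul_pastEntropy_le (μ := μ) hV hinv (a := 1) (j := k + 1) (by omega) n
    push_cast
    linarith

/-- Row `0` is bounded crudely, site by site; only the later rows need the sharp estimate. -/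
lemma exists_jointEntropy_rect_le (hV : ∀ q, Measurable (V q))
    (hinv : ∀ w : ℤ, IdentDistrib (fun ω q => V q ω) (fun ω q => V (q.1, q.2 + w) ω) μ μ)
    {ε : ℝ} (hε : 0 < ε) (k : ℕ) :
    ∃ M : ℝ, ∀ n : ℕ, jointEntropy V μ (rect 0 (k + 1) n) ≤
      n * (Fintype.card S / Real.log 2 +
        ∑ j ∈ Finset.range k, (pastEntropy V μ 0 (j + 1) 0 + ε)) + M := by
  induction k with
  | zero =>
    refine ⟨0, fun n => ?_⟩
    have h1 := jointEntropy_rect_add_one (μ := μ) hV (le_refl 0) n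
    have h2 : jointEntropy V μ (rect 0 0 n) = 0 := by simp [rect, jointEntropy_empty]
    rw [h2, zero_add] at h1
    rw [Nat.cast_zero, zero_add, h1]
    simp only [Finset.range_zero, Finset.sum_empty, add_zero]
    have key : ∀ i ∈ Finset.range n,
        condEntropy (V (0, i)) (fieldSigma V ↑(rect 0 0 n ∪ rect 0 (0 + 1) i)) μ ≤
          Fintype.card S / Real.log 2 := fun i _ =>
      condEntropy_le_card_div (hV _) (fieldSigma_le hV _)
    simpa using Finset.sum_le_sum key
  | succ k ih =>
    obtain ⟨M, hM⟩ := ih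
    obtain ⟨M', hM'⟩ := exists_jointEntropy_sub_le (μ := μ) hV hinv (a := 0) (j := k + 1)
      (by omega) hε
    refine ⟨M + M', fun n => ?_⟩
    have h1 := hM n
    have h2 := hM' n
    rw [Finset.sum_range_succ]
    push_cast
    linarith

lemma le_of_forall_nat_mul_le {x y M : ℝ} (h : ∀ n : ℕ, n * x ≤ n * y + M) : x ≤ y := by
  by_contra! hxy
  obtain ⟨n, hn⟩ := exists_nat_gt (M / (x - y))
  rw [div_lt_iff₀ (sub_pos.2 hxy)] at hn
  linarith [h n]

/-- Compare the rectangles with and without row `0`, divide by the width and let it tend to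
infinity, then let `ε` tend to `0`. The bound does not depend on `k`. -/
lemma sum_pastEntropy_sub_le (hV : ∀ q, Measurable (V q))
    (hinv : ∀ w : ℤ, IdentDistrib (fun ω q => V q ω) (fun ω q => V (q.1, q.2 + w) ω) μ μ)
    (k : ℕ) :
    ∑ j ∈ Finset.range k, (pastEntropy V μ 1 (j + 1) 0 - pastEntropy V μ 0 (j + 1) 0) ≤
      Fintype.card S / Real.log 2 := by
  have key : ∀ ε : ℝ, 0 < ε → ∑ j ∈ Finset.range k, pastEntropy V μ 1 (j + 1) 0 ≤
      Fintype.card S / Real.log 2 +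
        ∑ j ∈ Finset.range k, (pastEntropy V μ 0 (j + 1) 0 + ε) := fun ε hε => by
    obtain ⟨M, hM⟩ := exists_jointEntropy_rect_le (μ := μ) hV hinv hε k
    refine le_of_forall_nat_mul_le fun n => (mul_sum_pastEntropy_le hV hinv n k).trans
      ((jointEntropy_mono hV fun q hq => ?_).trans (hM n))
    rw [mem_rect] at hq ⊢
    omega
  rw [Finset.sum_sub_distrib, sub_le_iff_le_add]
  refine le_of_forall_pos_le_add fun δ hδ => ?_
  -- The error occurs `k` times; `k + 1` also covers `k = 0`.
  have h := key (δ / (k + 1)) (by positivity)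
  rw [Finset.sum_add_distrib, Finset.sum_const, Finset.card_range, nsmul_eq_mul] at h
  have : k * (δ / (k + 1)) ≤ δ := by
    rw [mul_div_assoc', div_le_iff₀ (by positivity)]
    nlinarith
  linarith

/-- For a horizontally stationary field, the conditional entropy of a far away row given the
past is asymptotically unaffected by knowledge of the row `0`. -/
theorem tendsto_pastEntropy_sub (hV : ∀ q, Measurable (V q))
    (hinv : ∀ w : ℤ, IdentDistrib (fun ω q => V q ω) (fun ω q => V (q.1, q.2 + w) ω) μ μ)
    (v : ℤ) :
    Tendsto (fun k : ℕ => pastEntropy V μ 1 k v - pastEntropy V μ 0 k v) atTop (𝓝 0) := by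
  simp_rw [pastEntropy_eq hV hinv _ _ v]
  -- The summed differences start at row `1`.
  rw [← tendsto_add_atTop_iff_nat 1]
  push_cast
  refine (summable_of_sum_range_le (fun j => sub_nonneg.2 ?_)
    (sum_pastEntropy_sub_le hV hinv)).tendsto_atTop_zero
  refine condEntropy_anti (hV _) (fieldSigma_mono V fun q hq => ?_) (fieldSigma_le hV _)
  simp only [lexPast, Set.mem_ofPred_eq] at hq ⊢
  omega

end Lattice

/-! ### The field made of the initial state and the observations. -/

section HiddenMarkovModel

instance : MeasurableSingletonClass ℤˣ :=
  ⟨fun x => ⟨{(x : ℤ)}, measurableSet_singleton _, by ext; simp [Units.ext_iff]⟩⟩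

/-- The field whose row `0` is the hidden state at time `0` and whose other rows are the
observations at the corresponding times. -/
def initialObsField {Ω E : Type*} (X Y : ℤ → Ω → ℤ → E) (q : ℤ × ℤ) (ω : Ω) : E :=
  if q.1 = 0 then X 0 ω q.2 else Y q.1 ω q.2

lemma identDistrib_initialObsField {Ω E : Type*} [MeasurableSpace E] {mΩ : MeasurableSpace Ω}
    {μ : Measure Ω} {X Y : ℤ → Ω → ℤ → E} (hinv : IsTranslationInvariant μ X Y) (w : ℤ) :
    IdentDistrib (fun ω q => initialObsField X Y q ω)
      (fun ω q => initialObsField X Y (q.1, q.2 + w) ω) μ μ := by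
  -- No time shift: row `0` plays a special role, but selecting `X` there and `Y` elsewhere commutes
  -- with horizontal shifts.
  have := (hinv 0 w).comp
    (u := fun (z : ℤ × ℤ → E × E) (q : ℤ × ℤ) => if q.1 = 0 then (z (0, q.2)).1 else (z q).2)
    (measurable_pi_lambda _ fun q => by split_ifs <;> fun_prop)
  convert this using 1 <;> ext ω q <;> simp [initialObsField]

lemma comap_eq_iSup {Ω E : Type*} [MeasurableSpace E] (f : Ω → ℤ → E) :
    MeasurableSpace.comap f inferInstance =
      ⨆ u, MeasurableSpace.comap (fun ω => f ω u) inferInstance := by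
  simp only [MeasurableSpace.pi, MeasurableSpace.comap_iSup, MeasurableSpace.comap_comp]
  rfl

lemma fieldSigma_lexPast_one {Ω E : Type*} [MeasurableSpace E] (X Y : ℤ → Ω → ℤ → E) {k : ℤ}
    (hk : 1 ≤ k) (v : ℤ) :
    fieldSigma (initialObsField X Y) (lexPast 1 k v) = obsPast Y k v := by
  have hY : ∀ (j u : ℤ), 1 ≤ j → initialObsField X Y (j, u) = fun ω => Y j ω u := fun j u hj => by
    ext ω
    simp [initialObsField, show j ≠ 0 by omega]
  simp only [obsPast, comap_eq_iSup]
  refine le_antisymm (iSup_le ?_) (sup_le (iSup_le fun j => iSup_le fun u => ?_)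
    (iSup_le fun w => ?_))
  · rintro ⟨⟨j, u⟩, h | h⟩
    · rw [hY _ _ h.1]
      refine le_sup_of_le_left ?_
      exact le_iSup_of_le (⟨j, h.1, by have := h.2; simp only at this; omega⟩ :
        {j : ℤ // 1 ≤ j ∧ j ≤ k - 1}) (le_iSup (fun u =>
          MeasurableSpace.comap (fun ω => Y j ω u) inferInstance) u)
    · obtain ⟨rfl, h⟩ := h
      rw [hY _ _ hk]
      refine le_sup_of_le_right ?_
      exact le_iSup (fun w : {w : ℤ // w < v} =>
        MeasurableSpace.comap (fun ω => Y j ω w) inferInstance) ⟨u, h⟩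
  · rw [← hY j u j.2.1]
    exact le_iSup (fun q : lexPast 1 k v =>
      MeasurableSpace.comap (initialObsField X Y q) inferInstance)
      ⟨(j, u), Or.inl ⟨j.2.1, by have := j.2.2; simp only; omega⟩⟩
  · rw [← hY k w hk]
    exact le_iSup (fun q : lexPast 1 k v =>
      MeasurableSpace.comap (initialObsField X Y q) inferInstance) ⟨(k, w), Or.inr ⟨rfl, w.2⟩⟩

lemma fieldSigma_lexPast_zero {Ω E : Type*} [MeasurableSpace E] (X Y : ℤ → Ω → ℤ → E) {k : ℤ}
    (hk : 1 ≤ k) (v : ℤ) :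
    fieldSigma (initialObsField X Y) (lexPast 0 k v) = initialField X ⊔ obsPast Y k v := by
  have hX : ∀ u : ℤ, initialObsField X Y (0, u) = fun ω => X 0 ω u := fun u => by
    ext ω
    simp [initialObsField]
  rw [← fieldSigma_lexPast_one X Y hk v]
  simp only [initialField, comap_eq_iSup]
  refine le_antisymm (iSup_le ?_) (sup_le (iSup_le fun u => ?_) (fieldSigma_mono _ fun q hq => ?_))
  · rintro ⟨⟨j, u⟩, h⟩
    by_cases hj : j = 0
    · subst hj
      rw [hX]
      exact le_sup_of_le_left (le_iSup (fun u =>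
        MeasurableSpace.comap (fun ω => X 0 ω u) inferInstance) u)
    · refine le_sup_of_le_right (le_iSup (fun q : lexPast 1 k v =>
        MeasurableSpace.comap (initialObsField X Y q) inferInstance) ⟨(j, u), ?_⟩)
      simp only [lexPast, Set.mem_ofPred_eq] at h ⊢
      omega
  · rw [← hX u]
    exact le_iSup (fun q : lexPast 0 k v =>
      MeasurableSpace.comap (initialObsField X Y q) inferInstance)
      ⟨(0, u), Or.inl ⟨le_rfl, by simp only; omega⟩⟩
  · simp only [lexPast, Set.mem_ofPred_eq] at hq ⊢
    omega

end HiddenMarkovModel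

end SpinFilter

end

theorem mainTheorem7 {Ω : Type*} [MeasurableSpace Ω] (μ : Measure Ω) [IsProbabilityMeasure μ]
    (X Y ξ : ℤ → Ω → ℤ → ℤˣ) (p : ℝ)
    (P : Kernel (ℤ → ℤˣ) (ℤ → ℤˣ)) [IsMarkovKernel P]
    (Φ : Kernel ((ℤ → ℤˣ) × (ℤ → ℤˣ)) (ℤ → ℤˣ)) [IsMarkovKernel Φ]
    (Ploc : ℤ → Kernel (ℤ → ℤˣ) ℤˣ) [∀ v, IsMarkovKernel (Ploc v)]
    (Φloc : ℤ → Kernel ((ℤ → ℤˣ) × (ℤ → ℤˣ)) ℤˣ) [∀ v, IsMarkovKernel (Φloc v)]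
    (hmm : SpinFilter.IsHiddenMarkovModel μ X Y P Φ)
    (hloc : SpinFilter.IsLocalModel P Φ Ploc Φloc)
    (hnoise : SpinFilter.HasSpinNoise μ X Y p ξ)
    (hker : SpinFilter.SameLocalKernels Ploc)
    (hinv : SpinFilter.IsTranslationInvariant μ X Y)
    (v : ℤ) :
    Tendsto
      (fun k : ℕ =>
        SpinFilter.condEntropy (fun ω => Y k ω v) (SpinFilter.obsPast Y k v) μ -
          SpinFilter.condEntropy (fun ω => Y k ω v)
            (SpinFilter.initialField X ⊔ SpinFilter.obsPast Y k v) μ)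
      atTop (𝓝 0) := by
  have hV : ∀ q, Measurable (SpinFilter.initialObsField X Y q) := fun q => by
    unfold SpinFilter.initialObsField
    split_ifs
    · exact (measurable_pi_apply q.2).comp (hmm.measurable_state 0)
    · exact (measurable_pi_apply q.2).comp (hmm.measurable_obs q.1)
  refine (SpinFilter.tendsto_pastEntropy_sub (μ := μ) hV
    (SpinFilter.identDistrib_initialObsField hinv) v).congr' ?_
  -- At `k = 0` the field shows the hidden state instead of the observation.
  filter_upwards [eventually_ge_atTop 1] with k hk
  have hk' : (1 : ℤ) ≤ k := by exact_mod_cast hk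
  have hVk : SpinFilter.initialObsField X Y ((k : ℤ), v) = fun ω => Y k ω v := by
    ext ω
    simp [SpinFilter.initialObsField, show k ≠ 0 by omega]
  simp only [SpinFilter.pastEntropy, SpinFilter.fieldSigma_lexPast_one X Y hk',
    SpinFilter.fieldSigma_lexPast_zero X Y hk', hVk]
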